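/- Let $G=(V,E)$ be a finite connected simple undirected graph with at least two vertices (hence at least one edge); write $N(v)$ for the set of neighbours of $v$ and $k_v=|N(v)|$ for its degree. The Circulated Neighbors Random Walk (CNRW) on $G$ is the following random sequence of vertices $X_0,X_1,X_2,\dots$. The first transition $X_0\to X_1$ is a directed edge of $G$ with an arbitrary law, and to every directed edge $x\to y$ a set $b(x,y)$ is attached, initially empty. Whenever the last transition of the walk is $u\to v$, the next vertex $w$ is chosen uniformly at random from $N(v)\setminus b(u,v)$, independently of the past given the current sets $b$ and the last transition; then $b(u,v)$ is replaced by $b(u,v)\cup\{w\}$, and if this equals $N(v)$, by $\emptyset$. (So, upon successive traversals of $u\to v$, the neighbours of $v$ are sampled without replacement, in rounds.) A walk is said to have stationary distribution $\pi$ if $$\lim_{n\to\infty}\frac1n\sum_{m=1}^n \Pr\{X_m=j\}=\pi(j)\qquad\text{for every } j\in V .$$ Then, for every law of the first transition, CNRW has the stationary distribution $$\pi(v)=\frac{k_v}{2|E|}\qquad (v\in V),$$ which is also the stationary distribution of the simple random walk on $G$ (the walk that moves from its current vertex to a uniformly chosen neighbour), for every law of its initial vertex. -/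

import Mathlib

open Filter Topology

namespace SimpleGraph

variable {V : Type*} [Fintype V] [DecidableEq V] (G : SimpleGraph V) [DecidableRel G.Adj]

/-- A state of the Circulated Neighbors Random Walk: the last transition `u → v`, given as the
directed edge `last = (u, v)`, and for every directed edge `(x, y)` the set `used (x, y)` of
neighbours of `y` already chosen after `x → y` in the current round. A completed round is
erased at once, so that `used (x, y)` is a proper subset of `N(y)`. -/
@[ext] structure CNRWState where
  last : G.Dart
  used : G.Dart → Finset V
  used_ssubset : ∀ d, used d ⊂ G.neighborFinset d.snd

namespace CNRWState

variable {G}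

/-- The initial state: the first transition is `d`, nothing has been chosen yet. -/
def init (d : G.Dart) : CNRWState G where
  last := d
  used := fun _ => ∅
  used_ssubset := fun e =>
    Finset.empty_ssubset.mpr ⟨e.fst, (G.mem_neighborFinset e.snd e.fst).mpr e.adj.symm⟩

/-- The vertices that may be chosen next after `u → v`: the set `N(v) \ b(u, v)`. -/
def candidates (s : CNRWState G) : Finset V :=
  G.neighborFinset s.last.snd \ s.used s.last

theorem candidates_nonempty (s : CNRWState G) : s.candidates.Nonempty :=
  Finset.sdiff_nonempty.mpr (s.used_ssubset s.last).2

theorem adj_of_mem_candidates (s : CNRWState G) {w : V} (hw : w ∈ s.candidates) :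
    G.Adj s.last.snd w :=
  (G.mem_neighborFinset _ _).mp (Finset.mem_sdiff.mp hw).1

/-- The new value of `b(u, v)` when `w` is chosen: `b(u, v) ∪ {w}`, reset to `∅` once it is
all of `N(v)`. -/
def record (s : CNRWState G) (w : V) : Finset V :=
  if insert w (s.used s.last) = G.neighborFinset s.last.snd then ∅ else insert w (s.used s.last)

theorem record_ssubset (s : CNRWState G) {w : V} (hw : w ∈ s.candidates) :
    s.record w ⊂ G.neighborFinset s.last.snd := by
  unfold record
  split_ifs with h
  · exact Finset.empty_ssubset.mpr ⟨w, (Finset.mem_sdiff.mp hw).1⟩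
  · exact (Finset.insert_subset (Finset.mem_sdiff.mp hw).1
      (s.used_ssubset s.last).1).ssubset_of_ne h

/-- The state after the choice of the candidate `w`: the last transition becomes `v → w`, and
only the memory of `u → v` changes. -/
def next (s : CNRWState G) (w : {w // w ∈ s.candidates}) : CNRWState G where
  last := ⟨(s.last.snd, w.1), s.adj_of_mem_candidates w.2⟩
  used := Function.update s.used s.last (s.record w.1)
  used_ssubset := by
    intro d
    by_cases h : d = s.last
    · subst h
      simpa using s.record_ssubset w.2
    · simpa [Function.update_of_ne h] using s.used_ssubset d

/-- One step of the walk: the next vertex is uniform on `N(v) \ b(u, v)`. -/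
noncomputable def step (s : CNRWState G) : PMF (CNRWState G) :=
  (PMF.uniformOfFinset s.candidates.attach
    (Finset.attach_nonempty_iff.mpr s.candidates_nonempty)).map s.next

end CNRWState

/-- The law of the state after `n` steps, when the first transition `X₀ → X₁` has law `μ` and
the memory is empty at the start. In this state the last transition is `Xₙ → Xₙ₊₁`. -/
noncomputable def cnrwStateLaw (μ : PMF G.Dart) : ℕ → PMF (CNRWState G)
  | 0 => μ.map CNRWState.init
  | n + 1 => (cnrwStateLaw μ n).bind CNRWState.step

/-- The law of the vertex `Xₘ` of the Circulated Neighbors Random Walk. -/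
noncomputable def cnrwLaw (μ : PMF G.Dart) (m : ℕ) : PMF V :=
  (G.cnrwStateLaw μ m).map fun s => s.last.fst

/-- One step of simple random walk: uniform on the neighbours of `v` (an isolated vertex, which
has no neighbour to move to, is left unchanged). -/
noncomputable def srwStep (v : V) : PMF V :=
  if h : (G.neighborFinset v).Nonempty then PMF.uniformOfFinset (G.neighborFinset v) h
  else PMF.pure v

/-- The law of the vertex `Xₘ` of simple random walk, when `X₀` has law `ν`. -/
noncomputable def srwLaw (ν : PMF V) : ℕ → PMF V
  | 0 => ν
  | n + 1 => (srwLaw ν n).bind G.srwStep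

end SimpleGraph

/-- A walk whose position `Xₘ` has law `X m` has stationary distribution `π` if, for every vertex
`j`, the long-run average of the probabilities `Pr{Xₘ = j}` exists and is `π j`. -/
def HasStationaryDistribution {V : Type*} (X : ℕ → PMF V) (π : V → ℝ) : Prop :=
  ∀ j : V, Tendsto (fun n : ℕ => (1 / (n : ℝ)) * ∑ m ∈ Finset.Icc 1 n, (X m j).toReal)
    atTop (𝓝 (π j))

/-! A completed round after `u → v` uses each neighbour of `v` exactly once, as often as its fair
share. So the number of choices of `w` minus the sum of the simple-random-walk probabilities of
moving to `w` is a function of the current memory alone, `excess`, which takes finitely many values.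
In expectation, the deviation of CNRW from one step of simple random walk therefore telescopes with
bounded partial sums (`excess_next`, `expect_step`). Hence the averaged laws are asymptotically
invariant under simple random walk. By compactness of the simplex and uniqueness of the invariant
vector on a connected graph, they converge. No ergodicity of the chain of states is needed. -/

namespace PMF

/-- The expectation of a real function under a law on a finite type. -/
noncomputable def expect {α : Type*} [Fintype α] (p : PMF α) (f : α → ℝ) : ℝ :=
  ∑ a, (p a).toReal * f a

variable {α β : Type*} [Fintype α] [Fintype β]

theorem sum_toReal (p : PMF α) : ∑ a, (p a).toReal = 1 := by
  rw [← ENNReal.toReal_sum fun a _ => p.apply_ne_top a, ← tsum_fintype (L := .unconditional α),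
    p.tsum_coe, ENNReal.toReal_one]

theorem expect_const (p : PMF α) (c : ℝ) : p.expect (fun _ => c) = c := by
  rw [expect, ← Finset.sum_mul, p.sum_toReal, one_mul]

theorem expect_sub (p : PMF α) (f g : α → ℝ) :
    p.expect (fun a => f a - g a) = p.expect f - p.expect g := by
  simp only [expect, mul_sub, Finset.sum_sub_distrib]

theorem expect_indicator [DecidableEq α] (p : PMF α) (b : α) :
    p.expect (fun a => if a = b then 1 else 0) = (p b).toReal := by
  simp [expect]

/-- The bound does not depend on `p`, so it serves all times at once. -/
theorem abs_expect_le (p : PMF α) (f : α → ℝ) : |p.expect f| ≤ ∑ a, |f a| := by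
  refine (Finset.abs_sum_le_sum_abs _ _).trans (Finset.sum_le_sum fun a _ => ?_)
  rw [abs_mul, abs_of_nonneg ENNReal.toReal_nonneg]
  exact mul_le_of_le_one_left (abs_nonneg _)
    (ENNReal.toReal_mono ENNReal.one_ne_top (p.coe_le_one a))

theorem expect_bind (p : PMF α) (k : α → PMF β) (f : β → ℝ) :
    (p.bind k).expect f = p.expect fun a => (k a).expect f := by
  have h : ∀ b, ((p.bind k) b).toReal = ∑ a, (p a).toReal * (k a b).toReal := fun b => by
    rw [bind_apply, tsum_fintype, ENNReal.toReal_sum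
      fun a _ => ENNReal.mul_ne_top (p.apply_ne_top a) ((k a).apply_ne_top b)]
    simp only [ENNReal.toReal_mul]
  simp only [expect, h, Finset.sum_mul, Finset.mul_sum]
  rw [Finset.sum_comm]
  simp only [mul_assoc]

theorem expect_pure [DecidableEq α] (a : α) (f : α → ℝ) : (PMF.pure a).expect f = f a := by
  rw [expect, Finset.sum_eq_single a (fun b _ hb => by simp [pure_apply, hb]) (by simp)]
  simp

theorem expect_map (p : PMF α) (g : α → β) (f : β → ℝ) :
    (p.map g).expect f = p.expect (f ∘ g) := by
  classical
  rw [← bind_pure_comp, expect_bind]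
  simp only [Function.comp_def, expect_pure]

end PMF

namespace SimpleGraph

variable {V : Type*} [Fintype V] (G : SimpleGraph V) [DecidableRel G.Adj]

/-- The probability that simple random walk moves from `v` to `w`. -/
noncomputable def srwProb (v w : V) : ℝ :=
  if G.Adj v w then 1 / (G.degree v : ℝ) else 0

variable {G}

theorem Connected.degree_ne_zero [Nontrivial V] (hG : G.Connected) (v : V) :
    (G.degree v : ℝ) ≠ 0 :=
  Nat.cast_ne_zero.mpr (hG.preconnected.degree_pos_of_nontrivial v).ne'

theorem Connected.degree_mul_srwProb [Nontrivial V] (hG : G.Connected) (v w : V) :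
    (G.degree v : ℝ) * G.srwProb v w = if G.Adj v w then 1 else 0 := by
  rw [srwProb, mul_ite, mul_one_div_cancel (hG.degree_ne_zero v), mul_zero]

theorem Connected.toReal_srwStep [Nontrivial V] (hG : G.Connected) (v w : V) :
    (G.srwStep v w).toReal = G.srwProb v w := by
  have hne : (G.neighborFinset v).Nonempty := by
    rw [← Finset.card_pos, card_neighborFinset_eq_degree]
    exact hG.preconnected.degree_pos_of_nontrivial v
  rw [srwStep, dif_pos hne, PMF.uniformOfFinset_apply, srwProb]
  simp only [mem_neighborFinset, card_neighborFinset_eq_degree]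
  split_ifs <;> simp

variable [DecidableEq V]

/-- On a connected graph, simple random walk has only one invariant probability vector. -/
theorem Connected.eq_degree_div_of_invariant [Nontrivial V] (hG : G.Connected) {p : V → ℝ}
    (hp : ∑ v, p v = 1) (hinv : ∀ w, ∑ v, p v * G.srwProb v w = p w) :
    p = fun v => (G.degree v : ℝ) / (2 * (G.edgeFinset.card : ℝ)) := by
  -- At `w` the Laplacian of `p / deg` is `p w` minus the mass that one step brings to `w`. Its
  -- kernel consists of the functions constant on components.
  have hlap : (G.lapMatrix ℝ).mulVec (fun v => p v / G.degree v) = 0 := by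
    funext w
    rw [lapMatrix_mulVec_apply, mul_div_cancel₀ _ (hG.degree_ne_zero w), Pi.zero_apply,
      sub_eq_zero, ← hinv w, neighborFinset_eq_filter, Finset.sum_filter]
    refine Finset.sum_congr rfl fun v _ => ?_
    simp only [srwProb, G.adj_comm w v]
    split_ifs <;> simp [div_eq_mul_inv]
  rw [lapMatrix_mulVec_eq_zero_iff_forall_reachable] at hlap
  obtain ⟨v₀⟩ := hG.nonempty
  have hconst : ∀ v, p v = G.degree v * (p v₀ / G.degree v₀) := fun v => by
    rw [hlap v₀ v (hG.preconnected v₀ v), mul_div_cancel₀ _ (hG.degree_ne_zero v)]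
  have hdeg : (∑ v, (G.degree v : ℝ)) = 2 * (G.edgeFinset.card : ℝ) := by
    exact_mod_cast G.sum_degrees_eq_twice_card_edges
  rw [Finset.sum_congr rfl fun v _ => hconst v, ← Finset.sum_mul, hdeg] at hp
  funext v
  rw [hconst v, eq_one_div_of_mul_eq_one_right hp, mul_one_div]

/-- Asymptotically invariant probability vectors converge to the invariant one. -/
theorem Connected.tendsto_of_asymptotically_invariant [Nontrivial V] (hG : G.Connected)
    {p : ℕ → V → ℝ} (hp : ∀ᶠ n in atTop, p n ∈ stdSimplex ℝ V)
    (hinv : ∀ w, Tendsto (fun n => ∑ v, p n v * G.srwProb v w - p n w) atTop (𝓝 0)) :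
    Tendsto p atTop (𝓝 fun v => (G.degree v : ℝ) / (2 * (G.edgeFinset.card : ℝ))) := by
  -- Every cluster point `q` is invariant, by continuity of the one-step defect, so only one is
  -- possible.
  refine (isCompact_stdSimplex ℝ V).tendsto_nhds_of_unique_mapClusterPt hp fun q hq hcl => ?_
  refine hG.eq_degree_div_of_invariant hq.2 fun w => ?_
  have hcont : Continuous fun r : V → ℝ => ∑ v, r v * G.srwProb v w - r w := by fun_prop
  exact sub_eq_zero.mp <| eq_of_nhds_neBot <|
    (hcl.continuousAt_comp hcont.continuousAt).clusterPt.mono (hinv w)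

/-- A walk whose one-step deviation from simple random walk telescopes, with bounded partial
sums, has the stationary distribution of simple random walk. -/
theorem Connected.hasStationaryDistribution_of_telescoping [Nontrivial V] (hG : G.Connected)
    {X : ℕ → PMF V} (H : V → ℕ → ℝ) {C : V → ℝ} (hH : ∀ w n, |H w n| ≤ C w)
    (hX : ∀ w n, (X (n + 2) w).toReal - ∑ v, (X (n + 1) v).toReal * G.srwProb v w
      = H w (n + 1) - H w n) :
    HasStationaryDistribution X
      (fun v => (G.degree v : ℝ) / (2 * (G.edgeFinset.card : ℝ))) := by
  refine tendsto_pi_nhds.mp (hG.tendsto_of_asymptotically_invariant ?_ fun w => ?_)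
  -- For `n = 0` the average is the zero vector, outside the simplex.
  · filter_upwards [eventually_gt_atTop 0] with n hn
    refine ⟨fun v => by positivity, ?_⟩
    rw [← Finset.mul_sum, Finset.sum_comm]
    simp only [PMF.sum_toReal]
    simp [hn.ne']
  · have key : ∀ n : ℕ, ∑ v, (1 / (n : ℝ) * ∑ m ∈ Finset.Icc 1 n, (X m v).toReal) * G.srwProb v w
        - 1 / (n : ℝ) * ∑ m ∈ Finset.Icc 1 n, (X m w).toReal
        = (1 / (n : ℝ)) * ((X (n + 1) w).toReal - (X 1 w).toReal - (H w n - H w 0)) := by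
      intro n
      have h₁ : ∑ m ∈ Finset.Icc 1 n, (∑ v, (X m v).toReal * G.srwProb v w - (X m w).toReal)
          = (X (n + 1) w).toReal - (X 1 w).toReal - (H w n - H w 0) := by
        induction n with
        | zero => simp
        | succ n ih =>
          rw [Finset.sum_Icc_succ_top (by omega), ih]
          linarith [hX w n]
      rw [← h₁, Finset.sum_sub_distrib, mul_sub, Finset.sum_comm]
      simp only [mul_assoc, ← Finset.mul_sum, Finset.sum_mul]
    simp only [key]
    -- The two probabilities contribute at most 2, the two values of `H` at most `2 * C w`.
    have hlim : Tendsto (fun n : ℕ => (1 / (n : ℝ)) * (2 + 2 * C w)) atTop (𝓝 0) := by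
      simpa using tendsto_one_div_atTop_nhds_zero_nat.mul_const (2 + 2 * C w)
    refine squeeze_zero_norm (fun n => ?_) hlim
    rw [Real.norm_eq_abs, abs_mul, abs_of_nonneg (by positivity : (0 : ℝ) ≤ 1 / n)]
    refine mul_le_mul_of_nonneg_left ?_ (by positivity)
    have hle : ∀ m, (X m w).toReal ≤ 1 := fun m =>
      ENNReal.toReal_mono ENNReal.one_ne_top ((X m).coe_le_one w)
    have hn := abs_le.mp (hH w n)
    have h0 := abs_le.mp (hH w 0)
    rw [abs_le]
    constructor <;>
      linarith [hle (n + 1), hle 1, @ENNReal.toReal_nonneg (X (n + 1) w),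
        @ENNReal.toReal_nonneg (X 1 w)]

theorem Connected.hasStationaryDistribution_srwLaw [Nontrivial V] (hG : G.Connected)
    (ν : PMF V) : HasStationaryDistribution (G.srwLaw ν)
      (fun v => (G.degree v : ℝ) / (2 * (G.edgeFinset.card : ℝ))) := by
  refine hG.hasStationaryDistribution_of_telescoping (fun _ _ => 0) (C := 0) (by simp)
    fun w n => ?_
  have h : (G.srwLaw ν (n + 2) w).toReal
      = (G.srwLaw ν (n + 1)).expect fun v => G.srwProb v w := by
    rw [srwLaw, ← PMF.expect_indicator, PMF.expect_bind]
    simp only [PMF.expect_indicator, hG.toReal_srwStep]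
  rw [h, sub_self]
  exact sub_self _

namespace CNRWState

instance instFinite : Finite (CNRWState G) :=
  Finite.of_injective (fun s : CNRWState G => (s.last, s.used)) fun _ _ h =>
    CNRWState.ext (congrArg Prod.fst h) (congrArg Prod.snd h)

noncomputable instance instFintype : Fintype (CNRWState G) := Fintype.ofFinite _

/-- The excess, over its fair share, of the number of times that `w` was chosen in the current
rounds. -/
noncomputable def excess (s : CNRWState G) (w : V) : ℝ :=
  ∑ d : G.Dart, ((if w ∈ s.used d then 1 else 0)
    - (s.used d).card * G.srwProb d.snd w)

/-- Only the summand of the traversed edge changes. Erasing a full round costs nothing, because its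
summand is `1 - k_v / k_v` or `0 - 0`. -/
theorem excess_next [Nontrivial V] (hG : G.Connected) (s : CNRWState G)
    (x : {x // x ∈ s.candidates}) (w : V) :
    (s.next x).excess w - s.excess w
      = (if x.1 = w then 1 else 0) - G.srwProb s.last.snd w := by
  rw [excess, excess, ← Finset.sum_sub_distrib, Finset.sum_eq_single s.last]
  · have hx := Finset.mem_sdiff.mp x.2
    have hu : (s.next x).used s.last = s.record x.1 := Function.update_self ..
    rw [hu, record]
    have hcard : ((insert x.1 (s.used s.last)).card : ℝ) = (s.used s.last).card + 1 := by
      rw [Finset.card_insert_of_notMem hx.2]; push_cast; rfl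
    have hmem : (if w ∈ insert x.1 (s.used s.last) then (1 : ℝ) else 0)
        = (if x.1 = w then 1 else 0) + if w ∈ s.used s.last then 1 else 0 := by
      by_cases hw : x.1 = w
      · subst hw
        simp [hx.2]
      · simp [hw, Ne.symm hw]
    by_cases h : insert x.1 (s.used s.last) = G.neighborFinset s.last.snd
    · rw [if_pos h]
      -- The round closes: the old set has `k_v - 1` elements and lacks only `x`.
      rw [h, card_neighborFinset_eq_degree] at hcard
      have hdeg := hG.degree_mul_srwProb s.last.snd w
      rw [h] at hmem
      simp only [mem_neighborFinset] at hmem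
      rw [hmem, hcard] at hdeg
      simp only [Finset.notMem_empty, if_false, Finset.card_empty, Nat.cast_zero]
      linarith
    · rw [if_neg h, hmem, hcard]
      ring
  · intro d _ hd
    have hu : (s.next x).used d = s.used d := Function.update_of_ne hd ..
    rw [hu, sub_self]
  · simp

/-- Subtracting the indicator makes the integrand the same for every candidate, so this is the
expectation of a constant. -/
theorem expect_step [Nontrivial V] (hG : G.Connected) (s : CNRWState G) (w : V) :
    s.step.expect (fun t => t.excess w - if t.last.snd = w then 1 else 0)
      = s.excess w - G.srwProb s.last.snd w := by
  rw [step, PMF.expect_map, ← PMF.expect_const (PMF.uniformOfFinset s.candidates.attach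
    (Finset.attach_nonempty_iff.mpr s.candidates_nonempty)) (s.excess w - G.srwProb s.last.snd w)]
  congr 1
  funext x
  have h : (s.next x).last.snd = x.1 := rfl
  simp only [Function.comp_apply, h]
  linarith [s.excess_next hG x w]

theorem map_fst_step (s : CNRWState G) :
    s.step.map (fun t => t.last.fst) = PMF.pure s.last.snd := by
  rw [step, PMF.map_comp]
  exact PMF.map_const _ _

end CNRWState

theorem cnrwLaw_succ (μ : PMF G.Dart) (m : ℕ) :
    G.cnrwLaw μ (m + 1) = (G.cnrwStateLaw μ m).map fun s => s.last.snd := by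
  rw [cnrwLaw, cnrwStateLaw, PMF.map_bind]
  simp only [CNRWState.map_fst_step]
  exact PMF.bind_pure_comp _ _

theorem toReal_cnrwLaw_succ (μ : PMF G.Dart) (m : ℕ) (w : V) :
    (G.cnrwLaw μ (m + 1) w).toReal
      = (G.cnrwStateLaw μ m).expect fun s => if s.last.snd = w then 1 else 0 := by
  rw [cnrwLaw_succ, ← PMF.expect_indicator, PMF.expect_map]
  rfl

theorem Connected.hasStationaryDistribution_cnrwLaw [Nontrivial V] (hG : G.Connected)
    (μ : PMF G.Dart) : HasStationaryDistribution (G.cnrwLaw μ)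
      (fun v => (G.degree v : ℝ) / (2 * (G.edgeFinset.card : ℝ))) := by
  refine hG.hasStationaryDistribution_of_telescoping
    (fun w n => (G.cnrwStateLaw μ n).expect fun s => s.excess w)
    (fun w n => PMF.abs_expect_le _ _) fun w n => ?_
  have hstep : (G.cnrwStateLaw μ (n + 1)).expect
      (fun t => t.excess w - if t.last.snd = w then 1 else 0)
      = (G.cnrwStateLaw μ n).expect fun s => s.excess w - G.srwProb s.last.snd w := by
    rw [cnrwStateLaw, PMF.expect_bind]
    simp only [CNRWState.expect_step hG]
  have hsrw : ∑ v, (G.cnrwLaw μ (n + 1) v).toReal * G.srwProb v w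
      = (G.cnrwStateLaw μ n).expect fun s => G.srwProb s.last.snd w := by
    rw [cnrwLaw_succ]
    exact PMF.expect_map _ _ _
  -- State `n + 1` ends in the vertex `Xₙ₊₂`, state `n` in `Xₙ₊₁`; this is the index shift in the
  -- telescoping hypothesis.
  rw [PMF.expect_sub, PMF.expect_sub, ← toReal_cnrwLaw_succ] at hstep
  rw [hsrw]
  linarith

end SimpleGraph

theorem theorem1 {V : Type*} [Fintype V] [DecidableEq V] [Nontrivial V]
    (G : SimpleGraph V) [DecidableRel G.Adj] (hG : G.Connected) :
    (∀ μ : PMF G.Dart, HasStationaryDistribution (G.cnrwLaw μ)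
      (fun v => (G.degree v : ℝ) / (2 * (G.edgeFinset.card : ℝ)))) ∧
    (∀ ν : PMF V, HasStationaryDistribution (G.srwLaw ν)
      (fun v => (G.degree v : ℝ) / (2 * (G.edgeFinset.card : ℝ)))) :=
  ⟨hG.hasStationaryDistribution_cnrwLaw, hG.hasStationaryDistribution_srwLaw⟩
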